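/- Let $2\le n\le\infty$ and let $\mathcal O_n$ be the Cuntz algebra, the unital $C^*$-algebra universally generated by $s_i$ ($1\le i\le n$ if $n<\infty$, $i\ge 1$ if $n=\infty$) with $s_i^*s_j=\delta_{ij}I$ and, if $n<\infty$, $\sum_{i=1}^n s_is_i^*=I$, respectively, if $n=\infty$, $\sum_{i=1}^k s_is_i^*\le I$ for all $k$. For a state $\omega$ on $\mathcal O_n$ with GNS representation $(\mathcal H,\pi,\Omega)$, let $\mathcal K(\omega)$ be the closed linear span of the vectors $\pi(s_{j_1}\cdots s_{j_l})^*\Omega$ over all finite words $(j_1,\dots,j_l)$, $l\ge 0$, of letters (the empty product being $I$). Put $\operatorname{cdim}\omega=\dim\mathcal K(\omega)\in\{1,2,\dots,\infty\}$ and let $\kappa(\omega)$ be the minimum of $\operatorname{cdim}\omega'$ over all states $\omega'$ on $\mathcal O_n$ whose GNS representation is unitarily equivalent to that of $\omega$. The state $\omega$ is called minimal if $\operatorname{cdim}\omega=\kappa(\omega)$. Let $\Lambda$ be the set of all sequences $x=(x_1,x_2,\dots)$ of letters, that is, $\Lambda=\{1,\dots,n\}^{\mathbb N}$ if $n<\infty$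 and $\Lambda=\{1,2,\dots\}^{\mathbb N}$ if $n=\infty$. Let $\Pi$ be the shift representation of $\mathcal O_n$ on $\ell^2(\Lambda)$, given on the standard basis by $\Pi(s_i)e_x=e_{ix}$, where $ix=(i,x_1,x_2,\dots)$. For $x\in\Lambda$ let $\omega_x=\langle e_x,\Pi(\cdot)e_x\rangle$. The sequence $x$ is eventually periodic if there are $i_0,p\ge1$ with $x_{i+p}=x_i$ for all $i\ge i_0$; the least $p\geq 1$ for which such an $i_0$ exists is then its period length. It is purely periodic if there is $d\ge1$ with $x_{i+d}=x_i$ for all $i\ge1$. Then for every $x\in\Lambda$: (i) $\omega_x$ is a pure state on $\mathcal O_n$. (a) If $x$ is not eventually periodic, then $\kappa(\omega_x)=\infty$. (b) If $x$ is eventually periodic with period length $d$, then $\kappa(\omega_x)=d$. (ii) If $x$ is eventually periodic, then $\omega_x$ is minimal if and only if $x$ is purely periodic. -/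

import Mathlib

open scoped ComplexOrder ENNReal InnerProductSpace

noncomputable section

namespace CuntzStates

/-! ### The Cuntz algebra -/

/-- The letters `1, …, n` if `n` is finite, and all positive integers if `n = ∞`. -/
abbrev Letter (n : ℕ∞) : Type := {i : ℕ // 1 ≤ i ∧ (i : ℕ∞) ≤ n}

/-- The Cuntz relations `sᵢ* sⱼ = δᵢⱼ 1`, together with `∑ᵢ sᵢ sᵢ* = 1` when `n` is finite (no
finite set of letters is exhaustive when `n = ∞`). For `n = ∞` the usual requirement
`s₁ s₁* + … + sₖ sₖ* ≤ 1` follows from the first relation, see `IsCuntzFamily.sum_le_one`. -/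
structure IsCuntzFamily (n : ℕ∞) {B : Type*} [CStarAlgebra B] (s : Letter n → B) : Prop where
  star_mul : ∀ i j, star (s i) * s j = if i = j then 1 else 0
  sum_mul_star : ∀ F : Finset (Letter n), (∀ i, i ∈ F) → ∑ i ∈ F, s i * star (s i) = 1

/-- Sums of the range projections of a Cuntz family are at most `1`. -/
theorem IsCuntzFamily.sum_le_one {n : ℕ∞} {B : Type*} [CStarAlgebra B] [PartialOrder B]
    [StarOrderedRing B] {s : Letter n → B} (h : IsCuntzFamily n s) (F : Finset (Letter n)) :
    ∑ i ∈ F, s i * star (s i) ≤ 1 := by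
  have hidem : (∑ i ∈ F, s i * star (s i)) * (∑ i ∈ F, s i * star (s i))
      = ∑ i ∈ F, s i * star (s i) := by
    rw [Finset.sum_mul_sum]
    refine Finset.sum_congr rfl fun i hi => ?_
    rw [Finset.sum_eq_single i]
    · rw [mul_assoc, ← mul_assoc (star (s i)), h.star_mul]; simp
    · intro j _ hj
      rw [mul_assoc, ← mul_assoc (star (s i)), h.star_mul]; simp [Ne.symm hj]
    · exact fun hi' => absurd hi hi'
  have hsa : star (∑ i ∈ F, s i * star (s i)) = ∑ i ∈ F, s i * star (s i) := by
    simp [star_sum]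
  rw [← sub_nonneg]
  have : (1 : B) - ∑ i ∈ F, s i * star (s i)
      = star (1 - ∑ i ∈ F, s i * star (s i)) * (1 - ∑ i ∈ F, s i * star (s i)) := by
    rw [star_sub, hsa, star_one, sub_mul, mul_sub, mul_sub, hidem]; simp
  rw [this]
  exact star_mul_self_nonneg _

/-- A nonzero unital C⋆-algebra together with a Cuntz family in it. -/
structure CuntzModel (n : ℕ∞) : Type 1 where
  carrier : Type
  [cstar : CStarAlgebra carrier]
  [nontriv : Nontrivial carrier]
  gen : Letter n → carrier
  isCuntz : IsCuntzFamily n gen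

attribute [instance] CuntzModel.cstar CuntzModel.nontriv

theorem CuntzModel.norm_gen_le {n : ℕ∞} (M : CuntzModel n) (i : Letter n) : ‖M.gen i‖ ≤ 1 := by
  have h := CStarRing.norm_star_mul_self (x := M.gen i)
  rw [M.isCuntz.star_mul, if_pos rfl, norm_one] at h
  nlinarith [norm_nonneg (M.gen i)]

/-- The C⋆-algebra of bounded families indexed by all Cuntz models. -/
abbrev ModelProduct (n : ℕ∞) : Type 1 := lp (fun M : CuntzModel n => M.carrier) ∞

instance (n : ℕ∞) : CStarAlgebra (ModelProduct n) where
  __ := (lp.inftyNormedRing : NormedRing (ModelProduct n))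
  __ := (lp.inftyStarRing : StarRing (ModelProduct n))
  __ := (inferInstance : CompleteSpace (ModelProduct n))
  __ := (lp.inftyCStarRing : CStarRing (ModelProduct n))
  __ := (lp.inftyNormedAlgebra : NormedAlgebra ℂ (ModelProduct n))
  __ := (inferInstance : StarModule ℂ (ModelProduct n))

/-- The family of all the `i`-th generators. -/
def universalGen (n : ℕ∞) (i : Letter n) : ModelProduct n :=
  ⟨fun M => M.gen i, memℓp_infty ⟨1, by rintro _ ⟨M, rfl⟩; exact M.norm_gen_le i⟩⟩

/-- The C⋆-algebra generated by the universal family inside the product of all models. -/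
def CuntzSubalgebra (n : ℕ∞) : StarSubalgebra ℂ (ModelProduct n) :=
  (StarAlgebra.adjoin ℂ (Set.range (universalGen n))).topologicalClosure

/-- The Cuntz algebra `𝒪ₙ`: the C⋆-algebra universally generated by a Cuntz family, see
`isCuntzFamily_gen` and `existsUnique_lift`. -/
def CuntzAlgebra (n : ℕ∞) : Type 1 := CuntzSubalgebra n

/-- The C⋆-algebra structure of `𝒪ₙ`, inherited from the product of all models. -/
def cuntzCStarAlgebra (n : ℕ∞) : CStarAlgebra (CuntzAlgebra n) :=
  StarSubalgebra.cstarAlgebra (CuntzSubalgebra n)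
    (h_closed := StarSubalgebra.isClosed_topologicalClosure _)

instance (n : ℕ∞) : CStarAlgebra (CuntzAlgebra n) := cuntzCStarAlgebra n

/-- The usual order of a C⋆-algebra: the nonnegative elements are those of the form `b* b`. -/
instance (n : ℕ∞) : PartialOrder (CuntzAlgebra n) := CStarAlgebra.spectralOrder _

instance (n : ℕ∞) : StarOrderedRing (CuntzAlgebra n) := CStarAlgebra.spectralOrderedRing _

/-- The Cuntz generators `sᵢ`. -/
def gen {n : ℕ∞} (i : Letter n) : CuntzAlgebra n :=
  (⟨universalGen n i, StarSubalgebra.le_topologicalClosure _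
    (StarAlgebra.subset_adjoin ℂ _ ⟨i, rfl⟩)⟩ : CuntzSubalgebra n)

theorem isCuntzFamily_gen (n : ℕ∞) : IsCuntzFamily n (gen (n := n)) where
  star_mul i j := by
    apply Subtype.ext
    apply lp.ext
    funext M
    have h := M.isCuntz.star_mul i j
    by_cases hij : i = j
    · rw [if_pos hij] at h ⊢; exact h
    · rw [if_neg hij] at h ⊢; exact h
  sum_mul_star F hF := by
    apply Subtype.ext
    apply lp.ext
    funext M
    have h := M.isCuntz.sum_mul_star F hF
    let ev : CuntzAlgebra n →+ M.carrier :=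
      { toFun := fun a => (show CuntzSubalgebra n from a).1 M
        map_zero' := rfl
        map_add' := fun _ _ => rfl }
    change ev (∑ i ∈ F, gen i * star (gen i)) = 1
    rw [map_sum]
    exact h

/-- The homomorphism from `𝒪ₙ` to a given model. -/
def lift {n : ℕ∞} (M : CuntzModel n) : CuntzAlgebra n →⋆ₐ[ℂ] M.carrier where
  toFun a := (show CuntzSubalgebra n from a).1 M
  map_one' := rfl
  map_mul' _ _ := rfl
  map_zero' := rfl
  map_add' _ _ := rfl
  commutes' _ := rfl
  map_star' _ := rfl

theorem lift_gen {n : ℕ∞} (M : CuntzModel n) (i : Letter n) : lift M (gen i) = M.gen i := rfl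

/-- The universal property of `𝒪ₙ`. -/
theorem existsUnique_lift {n : ℕ∞} {B : Type} [CStarAlgebra B] [Nontrivial B] {t : Letter n → B}
    (ht : IsCuntzFamily n t) :
    ∃! φ : CuntzAlgebra n →⋆ₐ[ℂ] B, ∀ i, φ (gen i) = t i := by
  refine ⟨lift ⟨B, t, ht⟩, fun i => rfl, fun ψ hψ => ?_⟩
  have hψc : Continuous ψ :=
    AddMonoidHomClass.continuous_of_bound ψ 1 fun a => by
      simpa using NonUnitalStarAlgHom.norm_apply_le ψ a
  have hlc : Continuous (lift ⟨B, t, ht⟩) :=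
    AddMonoidHomClass.continuous_of_bound (lift ⟨B, t, ht⟩) 1 fun a => by
      simpa using NonUnitalStarAlgHom.norm_apply_le (lift ⟨B, t, ht⟩) a
  refine StarAlgHom.ext_topologicalClosure (R := ℂ) (A := ModelProduct n)
    (S := StarAlgebra.adjoin ℂ (Set.range (universalGen n))) hψc hlc ?_
  refine StarAlgHom.ext_adjoin (F := _ →⋆ₐ[ℂ] B) fun y hy => ?_
  obtain ⟨y, hy'⟩ := y
  obtain ⟨i, rfl⟩ := hy
  exact hψ i

/-- The product `s_J = s_{j₁} ⋯ s_{jₗ}` for a finite word `J`, with `s_∅ = 1`. -/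
def wordGen {n : ℕ∞} (J : List (Letter n)) : CuntzAlgebra n := (J.map gen).prod

/-! ### States and their invariants -/

/-- The states on `𝒪ₙ`: positive linear functionals `ω` with `ω(1) = 1`. -/
abbrev State (n : ℕ∞) := {ω : CuntzAlgebra n →ₚ[ℂ] ℂ // ω 1 = 1}

/-- A state is pure if it is an extreme point of the convex set of all states. -/
def IsPure {n : ℕ∞} (ω : State n) : Prop :=
  ω.1.toLinearMap ∈ Set.extremePoints ℝ (Set.range fun φ : State n => φ.1.toLinearMap)

/-- The cyclic vector of the GNS representation. -/
def gnsVector {n : ℕ∞} (ω : State n) : ω.1.GNS := ((ω.1.toPreGNS 1 : ω.1.PreGNS) : ω.1.GNS)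

/-- `ω ∼ ω'`: the GNS representations are unitarily equivalent. -/
def GNSEquivalent {n : ℕ∞} (ω ω' : State n) : Prop :=
  ∃ U : ω.1.GNS ≃ₗᵢ[ℂ] ω'.1.GNS,
    ∀ a v, U (ω.1.gnsStarAlgHom a v) = ω'.1.gnsStarAlgHom a (U v)

/-- `𝒦(ω)`, the closed linear span of the vectors `π(s_J)* Ω`. -/
def corrSpace {n : ℕ∞} (ω : State n) : Submodule ℂ ω.1.GNS :=
  (Submodule.span ℂ (Set.range fun J : List (Letter n) =>
    star (ω.1.gnsStarAlgHom (wordGen J)) (gnsVector ω))).topologicalClosure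

/-- The dimension of `𝒦(ω)`, where every infinite dimension counts as `∞`. (An algebraic basis and
an orthonormal basis have the same size as soon as one of them is finite.) -/
def cdim {n : ℕ∞} (ω : State n) : ℕ∞ := Cardinal.toENat (Module.rank ℂ (corrSpace ω))

/-- `κ(ω)`, the minimum (attained, as `ℕ∞` is well ordered and `ω ∼ ω`) of `cdim ω'` over the states `ω' ∼ ω`. -/
def kappa {n : ℕ∞} (ω : State n) : ℕ∞ := sInf {k | ∃ ω' : State n, GNSEquivalent ω' ω ∧ cdim ω' = k}

/-- A state is minimal if `cdim ω = κ(ω)`. -/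
def IsMinimal {n : ℕ∞} (ω : State n) : Prop := cdim ω = kappa ω

/-! ### The shift representation -/

/-- Infinite sequences of letters; `x k` is the `(k + 1)`-st letter of `x`. -/
abbrev Seq (n : ℕ∞) : Type := ℕ → Letter n

/-- The concatenation `ix` of a letter and a sequence. -/
def cons {n : ℕ∞} (i : Letter n) (x : Seq n) : Seq n
  | 0 => i
  | k + 1 => x k

theorem cons_injective {n : ℕ∞} (i : Letter n) : Function.Injective (cons i) :=
  fun _ _ h => funext fun k => congrFun h (k + 1)

theorem cons_eta {n : ℕ∞} (y : Seq n) : cons (y 0) (fun k => y (k + 1)) = y := by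
  funext k; cases k <;> rfl

/-- The Hilbert space `ℓ²(Λ)`. -/
abbrev SeqSpace (n : ℕ∞) : Type := lp (fun _ : Seq n => ℂ) 2

open Classical in
/-- The standard basis vector `e_x`. -/
def basisVec {n : ℕ∞} (x : Seq n) : SeqSpace n := lp.single 2 x (1 : ℂ)

theorem orthonormal_basisVec (n : ℕ∞) : Orthonormal ℂ (basisVec (n := n)) := by
  classical
  refine ⟨fun x => ?_, fun x y hxy => ?_⟩
  · simp [basisVec, lp.norm_single]
  · simp [basisVec, lp.inner_single_left, hxy]

/-- The isometry of `ℓ²(Λ)` with `e_x ↦ e_{ix}`. -/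
def shiftIsometry {n : ℕ∞} (i : Letter n) : SeqSpace n →ₗᵢ[ℂ] SeqSpace n :=
  (((orthonormal_basisVec n).comp (cons i) (cons_injective i)).orthogonalFamily).linearIsometry

/-- The operator on `ℓ²(Λ)` with `e_x ↦ e_{ix}`. -/
def shiftOp {n : ℕ∞} (i : Letter n) : SeqSpace n →L[ℂ] SeqSpace n :=
  (shiftIsometry i).toContinuousLinearMap

theorem shiftOp_basisVec {n : ℕ∞} (i : Letter n) (x : Seq n) :
    shiftOp i (basisVec x) = basisVec (cons i x) := by
  classical
  refine (OrthogonalFamily.linearIsometry_apply_single (G := fun _ : Seq n => ℂ)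
    ((orthonormal_basisVec n).comp (cons i) (cons_injective i)).orthogonalFamily (1 : ℂ)).trans ?_
  simp

theorem inner_basisVec {n : ℕ∞} (x : Seq n) (v : SeqSpace n) : ⟪basisVec x, v⟫_ℂ = v x := by
  classical
  simp [basisVec, lp.inner_single_left]

theorem ext_basisVec {n : ℕ∞} {v w : SeqSpace n} (h : ∀ x, ⟪basisVec x, v⟫_ℂ = ⟪basisVec x, w⟫_ℂ) :
    v = w := by
  apply lp.ext
  funext x
  simpa only [inner_basisVec] using h x

theorem op_ext {n : ℕ∞} {S T : SeqSpace n →L[ℂ] SeqSpace n}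
    (h : ∀ x, S (basisVec x) = T (basisVec x)) : S = T := by
  have : star S = star T := by
    ext1 v
    refine ext_basisVec fun x => ?_
    rw [ContinuousLinearMap.star_eq_adjoint, ContinuousLinearMap.star_eq_adjoint,
      ContinuousLinearMap.adjoint_inner_right, ContinuousLinearMap.adjoint_inner_right, h]
  exact star_injective this

theorem star_shiftOp_cons {n : ℕ∞} (i j : Letter n) (x : Seq n) :
    star (shiftOp i) (basisVec (cons j x)) = if i = j then basisVec x else 0 := by
  refine ext_basisVec fun y => ?_
  rw [ContinuousLinearMap.star_eq_adjoint, ContinuousLinearMap.adjoint_inner_right,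
    shiftOp_basisVec]
  by_cases hij : i = j
  · subst hij
    rw [if_pos rfl]
    by_cases hyx : y = x
    · subst hyx
      simp [inner_self_eq_norm_sq_to_K, (orthonormal_basisVec n).1]
    · rw [(orthonormal_basisVec n).2 hyx,
        (orthonormal_basisVec n).2 fun h => hyx (cons_injective i h)]
  · rw [if_neg hij, inner_zero_right,
      (orthonormal_basisVec n).2 fun h => hij (congrFun h 0)]

theorem isCuntzFamily_shiftOp (n : ℕ∞) : IsCuntzFamily n (shiftOp (n := n)) where
  star_mul i j := by
    refine op_ext fun x => ?_
    rw [mul_apply_eq_comp, shiftOp_basisVec, star_shiftOp_cons]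
    split_ifs <;> simp
  sum_mul_star F hF := by
    refine op_ext fun y => ?_
    rw [sum_apply, Finset.sum_eq_single (y 0)]
    · have h := star_shiftOp_cons (y 0) (y 0) (fun k => y (k + 1))
      rw [cons_eta, if_pos rfl] at h
      rw [mul_apply_eq_comp, h, shiftOp_basisVec, cons_eta]
      rfl
    · intro i _ hi
      have h := star_shiftOp_cons i (y 0) (fun k => y (k + 1))
      rw [cons_eta, if_neg hi] at h
      rw [mul_apply_eq_comp, h, map_zero]
    · exact fun h => absurd (hF _) h

theorem nontrivial_operators {n : ℕ∞} (hn : 2 ≤ n) :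
    Nontrivial (SeqSpace n →L[ℂ] SeqSpace n) := by
  let x : Seq n := fun _ => ⟨1, le_rfl, le_trans (by norm_num) hn⟩
  have : Nontrivial (SeqSpace n) := ⟨basisVec x, 0, (orthonormal_basisVec n).ne_zero x⟩
  infer_instance

/-- The shift representation `Π` of `𝒪ₙ` on `ℓ²(Λ)`, given by `Π(sᵢ) e_x = e_{ix}`. -/
def shiftRep {n : ℕ∞} (hn : 2 ≤ n) : CuntzAlgebra n →⋆ₐ[ℂ] (SeqSpace n →L[ℂ] SeqSpace n) :=
  haveI := nontrivial_operators hn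
  lift ⟨SeqSpace n →L[ℂ] SeqSpace n, shiftOp, isCuntzFamily_shiftOp n⟩

theorem shiftRep_gen {n : ℕ∞} (hn : 2 ≤ n) (i : Letter n) (x : Seq n) :
    shiftRep hn (gen i) (basisVec x) = basisVec (cons i x) :=
  shiftOp_basisVec i x

/-- The vector state `ω_x = ⟨e_x, Π(·) e_x⟩`. -/
def shiftState {n : ℕ∞} (hn : 2 ≤ n) (x : Seq n) : State n :=
  ⟨PositiveLinearMap.mk₀
    { toFun := fun a => ⟪basisVec x, shiftRep hn a (basisVec x)⟫_ℂ
      map_add' := fun a b => by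
        rw [map_add, add_apply, inner_add_right]
      map_smul' := fun c a => by
        rw [map_smul, smul_apply, inner_smul_right]; rfl }
    (fun a ha => by
      obtain ⟨b, rfl⟩ := CStarAlgebra.nonneg_iff_eq_star_mul_self.mp ha
      change 0 ≤ ⟪basisVec x, shiftRep hn (star b * b) (basisVec x)⟫_ℂ
      rw [map_mul, map_star, mul_apply_eq_comp, ContinuousLinearMap.star_eq_adjoint,
        ContinuousLinearMap.adjoint_inner_right]
      rw [inner_self_eq_norm_sq_to_K]
      have h : (0 : ℝ) ≤ ‖shiftRep hn b (basisVec x)‖ ^ 2 := by positivity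
      simpa using Complex.zero_le_real.mpr h),
    by
      change ⟪basisVec x, shiftRep hn 1 (basisVec x)⟫_ℂ = 1
      rw [map_one, one_apply_eq_self, inner_self_eq_norm_sq_to_K,
        (orthonormal_basisVec n).1]
      simp⟩

theorem shiftState_apply {n : ℕ∞} (hn : 2 ≤ n) (x : Seq n) (a : CuntzAlgebra n) :
    (shiftState hn x).1 a = ⟪basisVec x, shiftRep hn a (basisVec x)⟫_ℂ := rfl

/-! ### Periodicity of sequences -/

/-- `x` is eventually periodic: for some `p ≥ 1`, `x_{i+p} = x_i` from some index on. -/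
def EventuallyPeriodic {n : ℕ∞} (x : Seq n) : Prop :=
  ∃ i₀ p : ℕ, 1 ≤ p ∧ ∀ i ≥ i₀, x (i + p) = x i

/-- `d` is the period length of `x`: the length of a shortest block `x'` such that
`x = x'' x' x' x' ⋯` for some finite word `x''`. -/
def IsPeriodLength {n : ℕ∞} (x : Seq n) (d : ℕ) : Prop :=
  IsLeast {p : ℕ | 1 ≤ p ∧ ∃ i₀ : ℕ, ∀ i ≥ i₀, x (i + p) = x i} d

/-- `x` is purely periodic: for some `d ≥ 1`, `x_{i+d} = x_i` for all `i`. -/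
def PurelyPeriodic {n : ℕ∞} (x : Seq n) : Prop :=
  ∃ d : ℕ, 1 ≤ d ∧ ∀ i, x (i + d) = x i

end CuntzStates

end

open scoped ComplexOrder ENNReal InnerProductSpace Topology
open Filter

noncomputable section

namespace CuntzStates

variable {n : ℕ∞}

/-! ### Words in the generators -/

/-! The elements `s_K s_L*` span a dense subspace of `𝒪ₙ`, and `ω_x` takes the value 1 on them if `x
= Kz = Lz` for a common `z`, and 0 otherwise. Purity: 1 is an extreme point of the unit disc, so a
state occurring in a convex decomposition of `ω_x` is also 1 wherever `ω_x` is. Its values on the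
range projections of prefixes of `x` then force all zeros (`state_wordGen_eq_zero`), so it equals
`ω_x`.

For `κ`, a state equivalent to `ω_x` is a vector state of `Π`, given by a nonzero `v` supported on
sequences tail equivalent to `x`; pick `y` with `v(y) ≠ 0`. Applying `Π(s_J)*` for longer and longer
prefixes `J` of `y` kills every other coordinate in the limit, leaving `v(y) e_{shift m y}` up to an
error tending to 0 (`tendsto_shiftRep_star_initial_sub`). If `x` has period length `d`, the shifts
of `y` eventually recur, so `d` distinct basis vectors lie in the closed span, giving `κ ≥ d`;
deleting the preperiod of `x` gives an equivalent state attaining `d`. If `x` is not eventually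
periodic, all shifts of `y` are distinct, and local compactness rules out finite dimension.

Minimality: `𝒦(ω_x)` corresponds to the closed span of the `e_{shift m x}`. There are `d` distinct
shifts if `x` is purely periodic, and at least `d + 1` otherwise. -/

@[simp] theorem wordGen_nil : wordGen ([] : List (Letter n)) = 1 := rfl

@[simp] theorem wordGen_cons (i : Letter n) (J : List (Letter n)) :
    wordGen (i :: J) = gen i * wordGen J := by simp [wordGen]

theorem wordGen_append (J K : List (Letter n)) :
    wordGen (J ++ K) = wordGen J * wordGen K := by simp [wordGen]

theorem star_gen_mul_gen_self (i : Letter n) : star (gen i) * gen i = 1 := by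
  rw [(isCuntzFamily_gen n).star_mul, if_pos rfl]

theorem star_gen_mul_gen_of_ne {i j : Letter n} (h : i ≠ j) : star (gen i) * gen j = 0 := by
  rw [(isCuntzFamily_gen n).star_mul, if_neg h]

theorem star_wordGen_mul_self (J : List (Letter n)) : star (wordGen J) * wordGen J = 1 := by
  induction J with
  | nil => simp
  | cons i J ih =>
    rw [wordGen_cons, star_mul, mul_assoc, ← mul_assoc (star (gen i)), star_gen_mul_gen_self,
      one_mul, ih]

theorem star_wordGen_mul_of_ne {J K : List (Letter n)} (hl : J.length = K.length) (h : J ≠ K) :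
    star (wordGen J) * wordGen K = 0 := by
  induction J generalizing K with
  | nil => exact absurd (List.length_eq_zero_iff.mp hl.symm).symm h
  | cons i J ih =>
    cases K with
    | nil => simp at hl
    | cons j K =>
      rw [wordGen_cons, wordGen_cons, star_mul, mul_assoc, ← mul_assoc (star (gen i))]
      by_cases hij : i = j
      · subst hij
        rw [star_gen_mul_gen_self, one_mul]
        exact ih (by simpa using hl) fun hJK => h (by rw [hJK])
      · rw [star_gen_mul_gen_of_ne hij, zero_mul, mul_zero]

theorem norm_wordGen_le (J : List (Letter n)) : ‖wordGen J‖ ≤ 1 := by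
  -- The C⋆-identity alone gives `‖1‖ ≤ 1`, so nontriviality of `𝒪ₙ` is not needed.
  have h := CStarRing.norm_star_mul_self (x := wordGen J)
  have h1 : ‖(1 : CuntzAlgebra n)‖ ≤ 1 := by
    have h2 := CStarRing.norm_star_mul_self (x := (1 : CuntzAlgebra n))
    rw [star_one, one_mul] at h2
    nlinarith [norm_nonneg (1 : CuntzAlgebra n)]
  rw [star_wordGen_mul_self] at h
  nlinarith [norm_nonneg (wordGen J)]

/-- The generators generate `𝒪ₙ` as a C⋆-algebra. -/
theorem dense_adjoin_gen :
    Dense (StarAlgebra.adjoin ℂ (Set.range (gen (n := n))) : Set (CuntzAlgebra n)) := by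
  intro a
  let ι : CuntzAlgebra n →⋆ₐ[ℂ] ModelProduct n := (CuntzSubalgebra n).subtype
  have hι : Topology.IsInducing ι := Topology.IsInducing.subtypeVal
  -- The closure in `𝒪ₙ` is pulled back from the closure in the product of models, where membership
  -- holds by the definition of `𝒪ₙ`.
  rw [hι.closure_eq_preimage_closure_image, Set.mem_preimage, ← StarSubalgebra.coe_map,
    StarAlgHom.map_adjoin, ← Set.range_comp]
  exact (show CuntzSubalgebra n from a).2

/-- Multiplying `s_K s_L*` on the left by `sᵢ` lengthens `K`; multiplying by `sᵢ*` cancels the first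
letter of `K`, gives zero, or, if `K` is empty, lengthens `L`. -/
theorem exists_wordGen_of_mem_closure {a : CuntzAlgebra n}
    (ha : a ∈ Submonoid.closure (Set.range (gen (n := n)) ∪ star (Set.range gen))) :
    a = 0 ∨ ∃ K L : List (Letter n), a = wordGen K * star (wordGen L) := by
  induction ha using Submonoid.closure_induction_left with
  | one => exact Or.inr ⟨[], [], by simp⟩
  | mul_left g hg b hb ih =>
    rcases ih with rfl | ⟨K, L, rfl⟩
    · exact Or.inl (mul_zero _)
    rcases hg with ⟨i, rfl⟩ | hg
    · exact Or.inr ⟨i :: K, L, by rw [wordGen_cons, mul_assoc]⟩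
    · obtain ⟨i, hi⟩ := hg
      obtain rfl : star (gen i) = g := by rw [hi, star_star]
      cases K with
      | nil => exact Or.inr ⟨[], L ++ [i], by simp [wordGen_append]⟩
      | cons j K =>
        rw [wordGen_cons, mul_assoc, ← mul_assoc]
        by_cases hij : i = j
        · subst hij
          exact Or.inr ⟨K, L, by rw [star_gen_mul_gen_self, one_mul]⟩
        · exact Or.inl (by rw [star_gen_mul_gen_of_ne hij, zero_mul])

/-- The elements `s_K s_L*` span a dense subspace of `𝒪ₙ`. -/
theorem eq_top_of_wordGen_mul_star_mem {S : Submodule ℂ (CuntzAlgebra n)}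
    (hS : IsClosed (S : Set (CuntzAlgebra n)))
    (h : ∀ K L : List (Letter n), wordGen K * star (wordGen L) ∈ S) : S = ⊤ := by
  have hle : Subalgebra.toSubmodule (Algebra.adjoin ℂ
      (Set.range (gen (n := n)) ∪ star (Set.range gen))) ≤ S := by
    rw [Algebra.adjoin_eq_span, Submodule.span_le]
    intro a ha
    rcases exists_wordGen_of_mem_closure ha with rfl | ⟨K, L, rfl⟩
    · exact S.zero_mem
    · exact h K L
  refine eq_top_iff.mpr fun a _ => ?_
  refine closure_minimal (fun b hb => hle ?_) hS (dense_adjoin_gen a)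
  rw [Subalgebra.mem_toSubmodule, ← StarAlgebra.adjoin_toSubalgebra]
  exact hb

/-! ### Infinite sequences -/

/-- The concatenation of a finite word and a sequence. -/
def append (K : List (Letter n)) (z : Seq n) : Seq n := K.foldr cons z

/-- The sequence `z` without its first `m` letters. -/
def shift (m : ℕ) (z : Seq n) : Seq n := fun k => z (k + m)

/-- The word of the first `m` letters of `z`. -/
def initial : ℕ → Seq n → List (Letter n)
  | 0, _ => []
  | m + 1, z => z 0 :: initial m (shift 1 z)

@[simp] theorem append_nil (z : Seq n) : append [] z = z := rfl

@[simp] theorem append_cons (i : Letter n) (K : List (Letter n)) (z : Seq n) :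
    append (i :: K) z = cons i (append K z) := rfl

theorem append_append (K L : List (Letter n)) (z : Seq n) :
    append (K ++ L) z = append K (append L z) := by simp [append]

@[simp] theorem length_initial (m : ℕ) (z : Seq n) : (initial m z).length = m := by
  induction m generalizing z with
  | zero => rfl
  | succ m ih => simp [initial, ih]

theorem shift_shift (k m : ℕ) (z : Seq n) : shift k (shift m z) = shift (k + m) z := by
  funext j; simp [shift, add_assoc]

@[simp] theorem shift_zero (z : Seq n) : shift 0 z = z := rfl

theorem append_initial_shift (m : ℕ) (z : Seq n) : append (initial m z) (shift m z) = z := by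
  induction m generalizing z with
  | zero => rfl
  | succ m ih =>
    have h := ih (shift 1 z)
    rw [shift_shift] at h
    rw [initial, append_cons, h]
    exact cons_eta z

theorem shift_length_append (K : List (Letter n)) (z : Seq n) :
    shift K.length (append K z) = z := by
  induction K with
  | nil => rfl
  | cons i K ih => exact ih

theorem cons_inj {i j : Letter n} {z w : Seq n} (h : cons i z = cons j w) : i = j ∧ z = w :=
  ⟨congrFun h 0, funext fun k => congrFun h (k + 1)⟩

theorem append_inj {K L : List (Letter n)} {z w : Seq n} (hl : K.length = L.length)
    (h : append K z = append L w) : K = L ∧ z = w := by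
  induction K generalizing L with
  | nil =>
    obtain rfl := List.length_eq_zero_iff.mp hl.symm
    exact ⟨rfl, h⟩
  | cons i K ih =>
    cases L with
    | nil => simp at hl
    | cons j L =>
      obtain ⟨rfl, h'⟩ := cons_inj h
      obtain ⟨rfl, rfl⟩ := ih (by simpa using hl) h'
      exact ⟨rfl, rfl⟩

theorem exists_initial_ne {z w : Seq n} (h : z ≠ w) :
    ∃ m₀, ∀ m ≥ m₀, initial m z ≠ initial m w := by
  obtain ⟨i, hi⟩ := Function.ne_iff.mp h
  refine ⟨i + 1, fun m hm => ?_⟩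
  obtain ⟨j, rfl⟩ := Nat.exists_eq_add_of_le hm
  clear h hm
  induction i generalizing z w with
  | zero =>
    rw [show 0 + 1 + j = j + 1 by omega]
    intro he
    exact hi (List.cons.inj he).1
  | succ i ih =>
    rw [show i + 1 + 1 + j = (i + 1 + j) + 1 by omega]
    intro he
    exact ih (z := shift 1 z) (w := shift 1 w) hi (List.cons.inj he).2

/-! ### The shift representation on words -/

theorem shiftRep_wordGen (hn : 2 ≤ n) (K : List (Letter n)) (z : Seq n) :
    shiftRep hn (wordGen K) (basisVec z) = basisVec (append K z) := by
  induction K with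
  | nil => simp
  | cons i K ih =>
    rw [wordGen_cons, map_mul, mul_apply_eq_comp, ih, shiftRep_gen, append_cons]

theorem shiftRep_star_wordGen_append (hn : 2 ≤ n) (K : List (Letter n)) (z : Seq n) :
    shiftRep hn (star (wordGen K)) (basisVec (append K z)) = basisVec z := by
  rw [← shiftRep_wordGen hn, ← mul_apply_eq_comp, ← map_mul, star_wordGen_mul_self]
  simp

theorem shiftRep_star_wordGen_of_ne (hn : 2 ≤ n) (K : List (Letter n)) {y : Seq n}
    (h : ∀ z, append K z ≠ y) : shiftRep hn (star (wordGen K)) (basisVec y) = 0 := by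
  refine ext_basisVec fun z => ?_
  rw [map_star, ContinuousLinearMap.star_eq_adjoint, ContinuousLinearMap.adjoint_inner_right,
    shiftRep_wordGen, (orthonormal_basisVec n).2 (h z), inner_zero_right]

theorem shiftRep_star_initial (hn : 2 ≤ n) (m : ℕ) (y : Seq n) :
    shiftRep hn (star (wordGen (initial m y))) (basisVec y) = basisVec (shift m y) := by
  have h := shiftRep_star_wordGen_append hn (initial m y) (shift m y)
  rwa [append_initial_shift] at h

theorem norm_basisVec (y : Seq n) : ‖basisVec y‖ = 1 := (orthonormal_basisVec n).1 y

theorem inner_basisVec_self (y : Seq n) : ⟪basisVec y, basisVec y⟫_ℂ = 1 := by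
  rw [inner_self_eq_norm_sq_to_K, norm_basisVec]; simp

/-! ### The GNS representation of a state -/

theorem gnsStarAlgHom_gnsVector (ω : State n) (a : CuntzAlgebra n) :
    ω.1.gnsStarAlgHom a (gnsVector ω) = ((ω.1.toPreGNS a : ω.1.PreGNS) : ω.1.GNS) := by
  refine (ω.1.gnsNonUnitalStarAlgHom_apply_coe (a := a) (b := ω.1.toPreGNS 1)).trans ?_
  rw [PositiveLinearMap.leftMulMapPreGNS_apply]
  simp

theorem inner_gnsStarAlgHom (ω : State n) (a b : CuntzAlgebra n) :
    ⟪ω.1.gnsStarAlgHom a (gnsVector ω), ω.1.gnsStarAlgHom b (gnsVector ω)⟫_ℂ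
      = ω.1 (star a * b) := by
  rw [gnsStarAlgHom_gnsVector, gnsStarAlgHom_gnsVector, UniformSpace.Completion.inner_coe,
    PositiveLinearMap.preGNS_inner_def]
  simp

theorem inner_gnsVector (ω : State n) (a : CuntzAlgebra n) :
    ⟪gnsVector ω, ω.1.gnsStarAlgHom a (gnsVector ω)⟫_ℂ = ω.1 a := by
  simpa using inner_gnsStarAlgHom ω 1 a

theorem norm_gnsVector (ω : State n) : ‖gnsVector ω‖ = 1 := by
  have h := inner_gnsVector ω 1
  rw [map_one, one_apply_eq_self, inner_self_eq_norm_sq_to_K, ω.2] at h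
  have h' : ‖gnsVector ω‖ ^ 2 = 1 := Complex.ofReal_injective (by simpa using h)
  nlinarith [norm_nonneg (gnsVector ω)]

theorem norm_state_apply_le (ω : State n) (a : CuntzAlgebra n) : ‖ω.1 a‖ ≤ ‖a‖ := by
  rw [← inner_gnsVector]
  calc _ ≤ ‖gnsVector ω‖ * ‖ω.1.gnsStarAlgHom a (gnsVector ω)‖ := norm_inner_le_norm _ _
    _ ≤ ‖gnsVector ω‖ * (‖ω.1.gnsStarAlgHom a‖ * ‖gnsVector ω‖) := by
      gcongr; exact ContinuousLinearMap.le_opNorm _ _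
    _ = ‖ω.1.gnsStarAlgHom a‖ := by rw [norm_gnsVector]; ring
    _ ≤ ‖a‖ := NonUnitalStarAlgHom.norm_apply_le _ a

theorem continuous_state (ω : State n) : Continuous ω.1 :=
  AddMonoidHomClass.continuous_of_bound ω.1 1 fun a => by
    simpa using norm_state_apply_le ω a

/-- States agree if they agree on the elements `s_K s_L*`. -/
theorem state_ext {φ ω : State n}
    (h : ∀ K L, φ.1 (wordGen K * star (wordGen L)) = ω.1 (wordGen K * star (wordGen L))) :
    φ = ω := by
  have htop := eq_top_of_wordGen_mul_star_mem
    (S := LinearMap.eqLocus φ.1.toLinearMap ω.1.toLinearMap)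
    (isClosed_eq (continuous_state φ) (continuous_state ω)) h
  refine Subtype.ext (DFunLike.ext _ _ fun a => ?_)
  have ha : a ∈ LinearMap.eqLocus φ.1.toLinearMap ω.1.toLinearMap := htop ▸ Submodule.mem_top
  exact ha

/-! ### Purity -/

theorem inner_shiftRep (hn : 2 ≤ n) (x : Seq n) (a b : CuntzAlgebra n) :
    ⟪shiftRep hn a (basisVec x), shiftRep hn b (basisVec x)⟫_ℂ
      = (shiftState hn x).1 (star a * b) := by
  rw [shiftState_apply, map_mul, map_star, mul_apply_eq_comp,
    ContinuousLinearMap.star_eq_adjoint, ContinuousLinearMap.adjoint_inner_right]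

theorem shiftState_wordGen_of_eq (hn : 2 ≤ n) {x z : Seq n} {K L : List (Letter n)}
    (hK : append K z = x) (hL : append L z = x) :
    (shiftState hn x).1 (wordGen K * star (wordGen L)) = 1 := by
  have h := inner_shiftRep hn x (star (wordGen K)) (star (wordGen L))
  rw [star_star] at h
  rw [← h]
  conv_lhs => rw [← hK]
  rw [shiftRep_star_wordGen_append, hK]
  conv_lhs => rw [← hL]
  rw [shiftRep_star_wordGen_append, inner_basisVec_self]

/-- A state taking the value `1` at all range projections of initial words of `x` vanishes at
`s_K s_L*` unless `x = Kz = Lz` for some `z`. -/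
theorem state_wordGen_eq_zero {φ : State n} {x : Seq n}
    (hφ : ∀ K z, append K z = x → φ.1 (wordGen K * star (wordGen K)) = 1)
    {K L : List (Letter n)} (h : ∀ z, append K z = x → append L z ≠ x) :
    φ.1 (wordGen K * star (wordGen L)) = 0 := by
  set π := φ.1.gnsStarAlgHom
  set Ω := gnsVector φ
  have hin : ∀ a b, ⟪π a Ω, π b Ω⟫_ℂ = φ.1 (star a * b) := inner_gnsStarAlgHom φ
  -- For the projection `p = s_J s_J*`, `‖pΩ - Ω‖² = φ(1 - p) = 0`.
  have hfix : ∀ J z, append J z = x → π (wordGen J * star (wordGen J)) Ω = Ω := by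
    intro J z hJ
    rw [← sub_eq_zero, ← inner_self_eq_zero (𝕜 := ℂ)]
    have h2 : π (wordGen J * star (wordGen J)) Ω - Ω
        = π (wordGen J * star (wordGen J) - 1) Ω := by
      rw [map_sub, map_one]; rfl
    have h3 : star (wordGen J * star (wordGen J) - 1) * (wordGen J * star (wordGen J) - 1)
        = 1 - wordGen J * star (wordGen J) := by
      have h4 : wordGen J * star (wordGen J) * (wordGen J * star (wordGen J))
          = wordGen J * star (wordGen J) := by
        rw [mul_assoc, ← mul_assoc (star (wordGen J)), star_wordGen_mul_self, one_mul]
      rw [star_sub, star_mul, star_star, star_one, sub_mul, mul_sub, h4]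
      simp
    rw [h2, hin, h3, map_sub, φ.2, hφ J z hJ, sub_self]
  have hprefix : ∀ J M z, append (J ++ M) z = x →
      π (star (wordGen J)) Ω = π (wordGen M * star (wordGen (J ++ M))) Ω := by
    intro J M z hz
    conv_lhs => rw [← hfix (J ++ M) z hz]
    rw [← mul_apply_eq_comp, ← map_mul, ← mul_assoc]
    conv_lhs => rw [wordGen_append, ← mul_assoc (star (wordGen J)), star_wordGen_mul_self,
      one_mul, ← wordGen_append]
  -- `Ω` is fixed by the range projection of the prefix of `x` of the same length as `J`, and `s_J*`
  -- annihilates that projection.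
  have hnot : ∀ J, (∀ z, append J z ≠ x) → π (star (wordGen J)) Ω = 0 := by
    intro J hJ
    have hne : J ≠ initial J.length x := fun he =>
      hJ (shift J.length x) (by conv_lhs => rw [he, length_initial, append_initial_shift])
    rw [← hfix _ _ (append_initial_shift J.length x), ← mul_apply_eq_comp, ← map_mul,
      ← mul_assoc, star_wordGen_mul_of_ne (by simp) hne, zero_mul, map_zero]
    rfl
  have hval : φ.1 (wordGen K * star (wordGen L))
      = ⟪π (star (wordGen K)) Ω, π (star (wordGen L)) Ω⟫_ℂ := by rw [hin, star_star]
  rw [hval]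
  by_cases hK : ∃ z, append K z = x
  · by_cases hL : ∃ w, append L w = x
    · obtain ⟨z, hz⟩ := hK
      obtain ⟨w, hw⟩ := hL
      -- Both `K` and `L` are prefixes of `x` but with different remainders. Extending each by `m`
      -- letters of its remainder, with `m` past the first difference, puts a product `s_M* s_N`
      -- with `M ≠ N` of equal length inside the inner product.
      have hzw : z ≠ w := fun he => h z hz (he ▸ hw)
      obtain ⟨m, hm⟩ := exists_initial_ne hzw
      rw [hprefix K (initial m z) (shift m z) (by rw [append_append, append_initial_shift, hz]),
        hprefix L (initial m w) (shift m w) (by rw [append_append, append_initial_shift, hw]),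
        hin, star_mul, mul_assoc, ← mul_assoc (star (wordGen (initial m z))),
        star_wordGen_mul_of_ne (by simp) (hm m le_rfl), zero_mul, mul_zero, map_zero]
    · rw [hnot L (by simpa using hL), inner_zero_right]
  · rw [hnot K (by simpa using hK), inner_zero_left]

/-- Extremality of 1 in the unit disc: the real parts must both be 1, which leaves no room for an
imaginary part. -/
theorem eq_one_of_convex_combination {a b : ℝ} {z w : ℂ} (ha : 0 < a) (hb : 0 < b)
    (hab : a + b = 1) (hz : ‖z‖ ≤ 1) (hw : ‖w‖ ≤ 1) (h : a • z + b • w = 1) : z = 1 := by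
  have hre : a * z.re + b * w.re = 1 := by simpa using congrArg Complex.re h
  have hz' := Complex.re_le_norm z
  have hw' := Complex.re_le_norm w
  have h1 : z.re = 1 := by nlinarith
  have h2 : z.re ^ 2 + z.im ^ 2 ≤ 1 := by
    have := Complex.normSq_eq_norm_sq z
    rw [Complex.normSq_apply] at this
    nlinarith [norm_nonneg z]
  refine Complex.ext h1 ?_
  rw [h1] at h2
  simpa using (show z.im = 0 by nlinarith [sq_nonneg z.im])

theorem isPure_shiftState (hn : 2 ≤ n) (x : Seq n) : IsPure (shiftState hn x) := by
  refine ⟨⟨_, rfl⟩, ?_⟩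
  rintro _ ⟨φ, rfl⟩ _ ⟨ψ, rfl⟩ ⟨a, b, ha, hb, hab, h⟩
  have hcomb : ∀ u, a • φ.1 u + b • ψ.1 u = (shiftState hn x).1 u :=
    fun u => LinearMap.congr_fun h u
  have hone : ∀ K L z, append K z = x → append L z = x →
      φ.1 (wordGen K * star (wordGen L)) = 1 := by
    intro K L z hK hL
    have hu : ‖wordGen K * star (wordGen L)‖ ≤ 1 := by
      refine (norm_mul_le _ _).trans ?_
      rw [norm_star]
      exact mul_le_one₀ (norm_wordGen_le K) (norm_nonneg _) (norm_wordGen_le L)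
    exact eq_one_of_convex_combination ha hb hab ((norm_state_apply_le φ _).trans hu)
      ((norm_state_apply_le ψ _).trans hu)
      ((hcomb _).trans (shiftState_wordGen_of_eq hn hK hL))
  suffices φ = shiftState hn x by rw [this]
  refine state_ext fun K L => ?_
  by_cases hz : ∃ z, append K z = x ∧ append L z = x
  · obtain ⟨z, hK, hL⟩ := hz
    rw [hone K L z hK hL, shiftState_wordGen_of_eq hn hK hL]
  · have hz' : ∀ z, append K z = x → append L z ≠ x := fun z hK hL => hz ⟨z, hK, hL⟩
    rw [state_wordGen_eq_zero (fun J z hJ => hone J J z hJ hJ) hz',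
      state_wordGen_eq_zero (fun J z hJ => shiftState_wordGen_of_eq hn hJ hJ) hz']

/-! ### The GNS representation of `ω_x` inside the shift representation -/

theorem norm_shiftRep_ofPreGNS (hn : 2 ≤ n) (x : Seq n) (a : (shiftState hn x).1.PreGNS) :
    ‖shiftRep hn ((shiftState hn x).1.ofPreGNS a) (basisVec x)‖ = ‖a‖ := by
  rw [← sq_eq_sq₀ (norm_nonneg _) (norm_nonneg _)]
  apply Complex.ofReal_injective
  rw [Complex.ofReal_pow, Complex.ofReal_pow, PositiveLinearMap.preGNS_norm_sq,
    ← inner_shiftRep, inner_self_eq_norm_sq_to_K]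
  rfl

/-- The map `a ↦ Π(a) e_x` before completion. -/
def orbitMap (hn : 2 ≤ n) (x : Seq n) : (shiftState hn x).1.PreGNS →L[ℂ] SeqSpace n :=
  LinearMap.mkContinuous
    { toFun := fun a => shiftRep hn ((shiftState hn x).1.ofPreGNS a) (basisVec x)
      map_add' := fun a b => by rw [map_add, map_add]; rfl
      map_smul' := fun c a => by rw [map_smul, map_smul]; rfl }
    1 fun a => by rw [one_mul]; exact (norm_shiftRep_ofPreGNS hn x a).le

/-- The isometry from the GNS space of `ω_x` into `ℓ²(Λ)` with `π(a) Ω ↦ Π(a) e_x`. -/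
def gnsEmbedding (hn : 2 ≤ n) (x : Seq n) : (shiftState hn x).1.GNS →ₗᵢ[ℂ] SeqSpace n where
  toLinearMap := (orbitMap hn x).fromCompletion.toLinearMap
  norm_map' v := by
    induction v using UniformSpace.Completion.induction_on with
    | hp => exact isClosed_eq (orbitMap hn x).fromCompletion.continuous.norm continuous_norm
    | ih a =>
      change ‖(orbitMap hn x).fromCompletion a‖ = _
      rw [ContinuousLinearMap.fromCompletion_apply_coe, UniformSpace.Completion.norm_coe]
      exact norm_shiftRep_ofPreGNS hn x a

theorem gnsEmbedding_coe (hn : 2 ≤ n) (x : Seq n) (a : (shiftState hn x).1.PreGNS) :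
    gnsEmbedding hn x a = shiftRep hn ((shiftState hn x).1.ofPreGNS a) (basisVec x) :=
  ContinuousLinearMap.fromCompletion_apply_coe (orbitMap hn x) a

theorem gnsEmbedding_gnsVector (hn : 2 ≤ n) (x : Seq n) :
    gnsEmbedding hn x (gnsVector (shiftState hn x)) = basisVec x := by
  refine (gnsEmbedding_coe hn x _).trans ?_
  simp

theorem gnsEmbedding_gnsStarAlgHom (hn : 2 ≤ n) (x : Seq n) (a : CuntzAlgebra n)
    (v : (shiftState hn x).1.GNS) :
    gnsEmbedding hn x ((shiftState hn x).1.gnsStarAlgHom a v)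
      = shiftRep hn a (gnsEmbedding hn x v) := by
  induction v using UniformSpace.Completion.induction_on with
  | hp =>
    exact isClosed_eq ((gnsEmbedding hn x).continuous.comp (ContinuousLinearMap.continuous _))
      ((ContinuousLinearMap.continuous _).comp (gnsEmbedding hn x).continuous)
  | ih b =>
    have h : (shiftState hn x).1.gnsStarAlgHom a (b : (shiftState hn x).1.GNS)
        = (((shiftState hn x).1.leftMulMapPreGNS a b : (shiftState hn x).1.PreGNS) :
          (shiftState hn x).1.GNS) :=
      (shiftState hn x).1.gnsNonUnitalStarAlgHom_apply_coe
    rw [h, gnsEmbedding_coe, gnsEmbedding_coe, PositiveLinearMap.leftMulMapPreGNS_apply]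
    simp

theorem gnsEmbedding_mem (hn : 2 ≤ n) (x : Seq n) {S : Submodule ℂ (SeqSpace n)}
    (hS : IsClosed (S : Set (SeqSpace n))) (h : ∀ a, shiftRep hn a (basisVec x) ∈ S)
    (v : (shiftState hn x).1.GNS) : gnsEmbedding hn x v ∈ S := by
  induction v using UniformSpace.Completion.induction_on with
  | hp => exact hS.preimage (gnsEmbedding hn x).continuous
  | ih b => rw [gnsEmbedding_coe]; exact h _

theorem isClosed_range_gnsEmbedding (hn : 2 ≤ n) (x : Seq n) :
    IsClosed ((gnsEmbedding hn x).toLinearMap.range : Set (SeqSpace n)) :=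
  (gnsEmbedding hn x).isometry.isClosedEmbedding.isClosed_range

theorem range_gnsEmbedding_le (hn : 2 ≤ n) {x y : Seq n} {a : CuntzAlgebra n}
    (h : shiftRep hn a (basisVec x) = basisVec y) :
    (gnsEmbedding hn y).toLinearMap.range ≤ (gnsEmbedding hn x).toLinearMap.range := by
  rintro _ ⟨v, rfl⟩
  refine gnsEmbedding_mem hn y (isClosed_range_gnsEmbedding hn x) (fun b => ?_) v
  refine ⟨(shiftState hn x).1.gnsStarAlgHom (b * a) (gnsVector _), ?_⟩
  change gnsEmbedding hn x _ = _
  rw [gnsEmbedding_gnsStarAlgHom, gnsEmbedding_gnsVector, map_mul, mul_apply_eq_comp, h]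

/-- With `J` the deleted prefix, `Π(s_J)` and `Π(s_J)*` carry the two basis vectors to each other.
They therefore generate the same cyclic subspace, and both GNS representations are the restriction
of `Π` to it. -/
theorem gnsEquivalent_shift (hn : 2 ≤ n) (x : Seq n) (m : ℕ) :
    GNSEquivalent (shiftState hn (shift m x)) (shiftState hn x) := by
  set y := shift m x
  set V := gnsEmbedding hn x
  set W := gnsEmbedding hn y
  have hr : W.toLinearMap.range = V.toLinearMap.range :=
    le_antisymm (range_gnsEmbedding_le hn (shiftRep_star_initial hn m x))
      (range_gnsEmbedding_le hn (a := wordGen (initial m x))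
        (by rw [shiftRep_wordGen, append_initial_shift]))
  let U := (W.equivRange.trans (LinearIsometryEquiv.ofEq _ _ hr)).trans V.equivRange.symm
  have hU : ∀ v, V (U v) = W v := fun v =>
    congrArg Subtype.val
      (V.equivRange.apply_symm_apply (LinearIsometryEquiv.ofEq _ _ hr (W.equivRange v)))
  refine ⟨U, fun a v => V.injective ?_⟩
  rw [hU, gnsEmbedding_gnsStarAlgHom, gnsEmbedding_gnsStarAlgHom, hU]

/-- The closed linear span of the vectors `Π(s_J)* v` in `ℓ²(Λ)`. -/
def shiftCorr (hn : 2 ≤ n) (v : SeqSpace n) : Submodule ℂ (SeqSpace n) :=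
  (Submodule.span ℂ (Set.range fun J : List (Letter n) =>
    shiftRep hn (star (wordGen J)) v)).topologicalClosure

theorem isClosed_shiftCorr (hn : 2 ≤ n) (v : SeqSpace n) :
    IsClosed (shiftCorr hn v : Set (SeqSpace n)) :=
  Submodule.isClosed_topologicalClosure _

theorem mem_shiftCorr (hn : 2 ≤ n) (v : SeqSpace n) (J : List (Letter n)) :
    shiftRep hn (star (wordGen J)) v ∈ shiftCorr hn v :=
  Submodule.le_topologicalClosure _ (Submodule.subset_span ⟨J, rfl⟩)

/-- An isometric intertwiner maps `𝒦(ω)` onto the corresponding closed span in `ℓ²(Λ)`, because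
isometries of complete spaces commute with closures. -/
theorem cdim_eq_of_intertwining (hn : 2 ≤ n) {ω : State n} (W : ω.1.GNS →ₗᵢ[ℂ] SeqSpace n)
    (hW : ∀ a v, W (ω.1.gnsStarAlgHom a v) = shiftRep hn a (W v)) :
    cdim ω = Cardinal.toENat (Module.rank ℂ (shiftCorr hn (W (gnsVector ω)))) := by
  have hmap : (corrSpace ω).map W.toLinearMap = shiftCorr hn (W (gnsVector ω)) := by
    apply SetLike.coe_injective
    rw [Submodule.map_coe, corrSpace, shiftCorr, Submodule.topologicalClosure_coe,
      Submodule.topologicalClosure_coe]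
    refine (W.isometry.isClosedEmbedding.closure_image_eq _).symm.trans ?_
    congr 1
    refine (Submodule.map_coe W.toLinearMap _).symm.trans ?_
    rw [Submodule.map_span, ← Set.range_comp]
    congr 3
    funext J
    change W (star (ω.1.gnsStarAlgHom (wordGen J)) (gnsVector ω)) = _
    rw [← map_star, hW]
  have e := Submodule.equivMapOfInjective W.toLinearMap W.injective (corrSpace ω)
  rw [hmap] at e
  -- The GNS space lives one universe above `ℓ²(Λ)`, so only lifted ranks can be compared;
  -- `Cardinal.toENat` does not see the lift.
  have h := congrArg Cardinal.toENat e.lift_rank_eq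
  rwa [Cardinal.toENat_lift, Cardinal.toENat_lift] at h

theorem cdim_shiftState (hn : 2 ≤ n) (x : Seq n) :
    cdim (shiftState hn x) = Cardinal.toENat (Module.rank ℂ (shiftCorr hn (basisVec x))) := by
  rw [cdim_eq_of_intertwining hn (gnsEmbedding hn x) (gnsEmbedding_gnsStarAlgHom hn x),
    gnsEmbedding_gnsVector]

/-! ### Tail equivalence -/

/-- Two sequences are tail equivalent if they agree after deleting finitely many letters. -/
def TailEquiv (x y : Seq n) : Prop := ∃ a b, shift a x = shift b y

/-- The vectors supported on the sequences that are tail equivalent to `x`. -/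
def tailSpace (x : Seq n) : Submodule ℂ (SeqSpace n) where
  carrier := {v | ∀ y, ¬ TailEquiv x y → ⟪basisVec y, v⟫_ℂ = 0}
  add_mem' hv hw y hy := by rw [inner_add_right, hv y hy, hw y hy, add_zero]
  zero_mem' y _ := inner_zero_right _
  smul_mem' c v hv y hy := by rw [inner_smul_right, hv y hy, mul_zero]

theorem isClosed_tailSpace (x : Seq n) : IsClosed (tailSpace x : Set (SeqSpace n)) := by
  have : (tailSpace x : Set (SeqSpace n))
      = ⋂ y, ⋂ _ : ¬ TailEquiv x y, {v | ⟪basisVec y, v⟫_ℂ = 0} := by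
    ext v; simp [tailSpace]
  rw [this]
  exact isClosed_iInter fun y => isClosed_iInter fun _ =>
    isClosed_eq (continuous_const.inner continuous_id) continuous_const

/-- For `a = s_K s_L*` the vector is zero or a basis vector whose index arises from `x` by replacing
the prefix `L` with `K`; density and closedness give the rest. -/
theorem shiftRep_mem_tailSpace (hn : 2 ≤ n) (x : Seq n) (a : CuntzAlgebra n) :
    shiftRep hn a (basisVec x) ∈ tailSpace x := by
  let T : CuntzAlgebra n →ₗ[ℂ] SeqSpace n :=
    { toFun := fun a => shiftRep hn a (basisVec x)
      map_add' := fun a b => by rw [map_add]; rfl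
      map_smul' := fun c a => by rw [map_smul]; rfl }
  have hT : Continuous T :=
    AddMonoidHomClass.continuous_of_bound T 1 fun a => by
      calc ‖shiftRep hn a (basisVec x)‖ ≤ ‖shiftRep hn a‖ * ‖basisVec x‖ :=
            ContinuousLinearMap.le_opNorm _ _
        _ ≤ 1 * ‖a‖ := by
          rw [norm_basisVec, mul_one, one_mul]
          exact NonUnitalStarAlgHom.norm_apply_le (shiftRep hn) a
  have htop := eq_top_of_wordGen_mul_star_mem (S := (tailSpace x).comap T)
    ((isClosed_tailSpace x).preimage hT) fun K L => by
      change shiftRep hn (wordGen K * star (wordGen L)) (basisVec x) ∈ tailSpace x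
      rw [map_mul, mul_apply_eq_comp]
      by_cases hL : ∃ z, append L z = x
      · obtain ⟨z, rfl⟩ := hL
        rw [shiftRep_star_wordGen_append, shiftRep_wordGen]
        intro y hy
        refine (orthonormal_basisVec n).2 fun h => hy ⟨L.length, K.length, ?_⟩
        rw [h, shift_length_append, shift_length_append]
      · rw [shiftRep_star_wordGen_of_ne hn L (by simpa using hL), map_zero]
        exact Submodule.zero_mem _
  have ha : a ∈ (tailSpace x).comap T := htop ▸ Submodule.mem_top
  exact ha

/-- A state equivalent to `ω_x` is a vector state of the shift representation, given by a vector
supported on the sequences that are tail equivalent to `x`. -/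
theorem exists_cdim_eq_of_gnsEquivalent (hn : 2 ≤ n) {x : Seq n} {ω : State n}
    (h : GNSEquivalent ω (shiftState hn x)) :
    ∃ v ∈ tailSpace x, v ≠ 0 ∧ cdim ω = Cardinal.toENat (Module.rank ℂ (shiftCorr hn v)) := by
  obtain ⟨U, hU⟩ := h
  let W := (gnsEmbedding hn x).comp U.toLinearIsometry
  have hW : ∀ a v, W (ω.1.gnsStarAlgHom a v) = shiftRep hn a (W v) := fun a v => by
    change gnsEmbedding hn x (U _) = shiftRep hn a (gnsEmbedding hn x (U v))
    rw [hU, gnsEmbedding_gnsStarAlgHom]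
  refine ⟨W (gnsVector ω), gnsEmbedding_mem hn x (isClosed_tailSpace x)
    (shiftRep_mem_tailSpace hn x) _, fun h0 => ?_, cdim_eq_of_intertwining hn W hW⟩
  have := W.norm_map (gnsVector ω)
  rw [h0, norm_zero, norm_gnsVector] at this
  exact zero_ne_one this

/-! ### Basis vectors in the closed span of the `Π(s_J)* v` -/

theorem topologicalClosure_span_basisVec :
    (Submodule.span ℂ (Set.range (basisVec (n := n)))).topologicalClosure = ⊤ := by
  rw [Submodule.topologicalClosure_eq_top_iff, Submodule.eq_bot_iff]
  intro v hv
  refine ext_basisVec fun x => ?_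
  rw [inner_zero_right]
  exact (Submodule.mem_orthogonal _ v).mp hv _ (Submodule.subset_span ⟨x, rfl⟩)

theorem norm_shiftRep_star_wordGen_le (hn : 2 ≤ n) (J : List (Letter n)) (v : SeqSpace n) :
    ‖shiftRep hn (star (wordGen J)) v‖ ≤ ‖v‖ := by
  calc _ ≤ ‖shiftRep hn (star (wordGen J))‖ * ‖v‖ := ContinuousLinearMap.le_opNorm _ _
    _ ≤ ‖star (wordGen J)‖ * ‖v‖ := by
      gcongr; exact NonUnitalStarAlgHom.norm_apply_le (shiftRep hn) _
    _ ≤ 1 * ‖v‖ := by gcongr; rw [norm_star]; exact norm_wordGen_le J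
    _ = ‖v‖ := one_mul _

theorem norm_inner_basisVec_le (y : Seq n) (v : SeqSpace n) : ‖⟪basisVec y, v⟫_ℂ‖ ≤ ‖v‖ := by
  simpa [norm_basisVec] using norm_inner_le_norm (𝕜 := ℂ) (basisVec y) v

/-- Removing longer and longer initial words of `y` from `v` leaves `v(y)` times a basis vector. -/
theorem tendsto_shiftRep_star_initial_sub (hn : 2 ≤ n) (y : Seq n) (v : SeqSpace n) :
    Tendsto (fun m => shiftRep hn (star (wordGen (initial m y))) v
      - ⟪basisVec y, v⟫_ℂ • basisVec (shift m y)) atTop (𝓝 0) := by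
  -- The maps `D m` are linear with norm at most 2 and eventually vanish on each basis vector, so
  -- they tend to 0 pointwise by density.
  let D : ℕ → SeqSpace n → SeqSpace n := fun m v =>
    shiftRep hn (star (wordGen (initial m y))) v - ⟪basisVec y, v⟫_ℂ • basisVec (shift m y)
  have hadd : ∀ m v w, D m (v + w) = D m v + D m w := fun m v w => by
    simp only [D, map_add, inner_add_right, add_smul]; abel
  have hsmul : ∀ m (c : ℂ) v, D m (c • v) = c • D m v := fun m c v => by
    simp only [D, map_smul, inner_smul_right, mul_smul, smul_sub]
  have hnorm : ∀ m v, ‖D m v‖ ≤ 2 * ‖v‖ := fun m v => by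
    refine (norm_sub_le _ _).trans ?_
    rw [norm_smul, norm_basisVec, mul_one]
    linarith [norm_shiftRep_star_wordGen_le hn (initial m y) v, norm_inner_basisVec_le y v]
  have hspan : ∀ w ∈ Submodule.span ℂ (Set.range (basisVec (n := n))),
      Tendsto (fun m => D m w) atTop (𝓝 0) := by
    intro w hw
    induction hw using Submodule.span_induction with
    | mem w hw =>
      obtain ⟨z, rfl⟩ := hw
      refine tendsto_const_nhds.congr' ?_
      by_cases hzy : z = y
      · subst hzy
        refine Eventually.of_forall fun m => ?_
        simp only [D, shiftRep_star_initial, inner_basisVec_self, one_smul, sub_self]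
      · obtain ⟨m₀, hm₀⟩ := exists_initial_ne hzy
        filter_upwards [eventually_ge_atTop m₀] with m hm
        have h1 : shiftRep hn (star (wordGen (initial m y))) (basisVec z) = 0 :=
          shiftRep_star_wordGen_of_ne hn _ fun u hu => hm₀ m hm
            (append_inj (by simp) ((append_initial_shift m z).trans hu.symm)).1
        simp only [D, h1, (orthonormal_basisVec n).2 (Ne.symm hzy), zero_smul, sub_zero]
    | zero => simp [D]
    | add v w _ _ hv hw => simpa only [hadd, add_zero] using hv.add hw
    | smul c v _ hv => simpa only [hsmul, smul_zero] using hv.const_smul c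
  change Tendsto (fun m => D m v) atTop (𝓝 0)
  rw [NormedAddGroup.tendsto_nhds_zero]
  intro ε hε
  have hv : v ∈ closure (Submodule.span ℂ (Set.range (basisVec (n := n))) : Set (SeqSpace n)) := by
    rw [← Submodule.topologicalClosure_coe, topologicalClosure_span_basisVec]; trivial
  obtain ⟨w, hw, hvw⟩ := Metric.mem_closure_iff.mp hv (ε / 4) (by linarith)
  filter_upwards [NormedAddGroup.tendsto_nhds_zero.mp (hspan w hw) (ε / 2) (by linarith)]
    with m hm
  have h1 : D m v = D m (v - w) + D m w := by rw [← hadd, sub_add_cancel]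
  rw [dist_eq_norm] at hvw
  rw [h1]
  calc _ ≤ ‖D m (v - w)‖ + ‖D m w‖ := norm_add_le _ _
    _ < ε := by linarith [hnorm m (v - w)]

/-- Along `m = k + q p` the vector `e_{shift m y}` is constant, so its multiple by `v(y)` is a
genuine limit of vectors in the closed span. -/
theorem basisVec_mem_shiftCorr (hn : 2 ≤ n) {y : Seq n} {v : SeqSpace n}
    (hv : ⟪basisVec y, v⟫_ℂ ≠ 0) {k p : ℕ} (hp : 1 ≤ p) (hy : shift (k + p) y = shift k y) :
    basisVec (shift k y) ∈ shiftCorr hn v := by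
  have hshift : ∀ q, shift (k + q * p) y = shift k y := by
    intro q
    induction q with
    | zero => simp
    | succ q ih =>
      rw [show k + (q + 1) * p = q * p + (k + p) by ring, ← shift_shift, hy, shift_shift,
        add_comm, ih]
  have hlim := (tendsto_shiftRep_star_initial_sub hn y v).comp
    (tendsto_atTop_mono (fun q : ℕ => show q ≤ k + q * p by nlinarith) tendsto_id)
  have hlim' := hlim.add_const (⟪basisVec y, v⟫_ℂ • basisVec (shift k y))
  rw [zero_add] at hlim'
  have hmem : ⟪basisVec y, v⟫_ℂ • basisVec (shift k y) ∈ shiftCorr hn v := by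
    refine (isClosed_shiftCorr hn v).mem_of_tendsto hlim' (Eventually.of_forall fun q => ?_)
    simp only [Function.comp_apply, hshift, sub_add_cancel]
    exact mem_shiftCorr hn v _
  exact ((shiftCorr hn v).smul_mem_iff hv).mp hmem

theorem le_rank_of_basisVec_mem {S : Submodule ℂ (SeqSpace n)} {d : ℕ} {f : Fin d → Seq n}
    (hf : Function.Injective f) (h : ∀ j, basisVec (f j) ∈ S) :
    (d : ℕ∞) ≤ Cardinal.toENat (Module.rank ℂ S) := by
  have hli : LinearIndependent ℂ fun j => (⟨basisVec (f j), h j⟩ : S) :=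
    LinearIndependent.of_comp S.subtype ((orthonormal_basisVec n).comp f hf).linearIndependent
  have := Cardinal.toENat.monotone' hli.cardinal_le_rank
  simpa using this

theorem exists_inner_ne_zero {v : SeqSpace n} (hv : v ≠ 0) : ∃ y, ⟪basisVec y, v⟫_ℂ ≠ 0 := by
  by_contra! h
  exact hv (ext_basisVec fun y => by rw [h, inner_zero_right])

/-! ### Periods -/

theorem eventually_period_iff {x : Seq n} {p : ℕ} :
    (∃ i₀ : ℕ, ∀ i ≥ i₀, x (i + p) = x i) ↔ ∃ k, shift (k + p) x = shift k x := by
  constructor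
  · rintro ⟨k, h⟩
    refine ⟨k, funext fun i => ?_⟩
    have := h (i + k) (Nat.le_add_left _ _)
    rwa [add_assoc] at this
  · rintro ⟨k, h⟩
    refine ⟨k, fun i hi => ?_⟩
    have := congrFun h (i - k)
    simp only [shift] at this
    rwa [show i - k + (k + p) = i + p by omega, Nat.sub_add_cancel hi] at this

/-- Eventual periods depend only on the tail. -/
theorem TailEquiv.exists_period_iff {x y : Seq n} (h : TailEquiv x y) {p : ℕ} :
    (∃ k, shift (k + p) x = shift k x) ↔ ∃ k, shift (k + p) y = shift k y := by
  obtain ⟨a, b, hab⟩ := h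
  have key : ∀ {x y : Seq n} {a b : ℕ}, shift a x = shift b y →
      (∃ k, shift (k + p) x = shift k x) → ∃ k, shift (k + p) y = shift k y := by
    rintro x y a b hab ⟨k, hk⟩
    refine ⟨k + b, ?_⟩
    have hcomm : ∀ m, shift (m + b) y = shift a (shift m x) := fun m => by
      rw [← shift_shift, ← hab, shift_shift, shift_shift, add_comm]
    rw [add_right_comm, hcomm, hcomm, hk]
  exact ⟨key hab, key hab.symm⟩

/-- A coincidence would make `j - i < d` an eventual period of `y`, hence of `x`. -/
theorem not_shift_eq_of_lt {x y : Seq n} {d : ℕ} (hd : IsPeriodLength x d) (hxy : TailEquiv x y)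
    {i j : ℕ} (hij : i < j) (hj : j < i + d) : shift i y ≠ shift j y := by
  intro h
  have hle : d ≤ j - i := hd.2 ⟨by omega, eventually_period_iff.mpr (hxy.exists_period_iff.mpr
    ⟨i, by rw [show i + (j - i) = j by omega, h]⟩)⟩
  omega

theorem TailEquiv.refl (x : Seq n) : TailEquiv x x := ⟨0, 0, rfl⟩

theorem EventuallyPeriodic.exists_isPeriodLength {x : Seq n} (h : EventuallyPeriodic x) :
    ∃ d, IsPeriodLength x d := by
  obtain ⟨i₀, p, hp, hi⟩ := h
  exact ⟨_, isLeast_csInf (s := {p : ℕ | 1 ≤ p ∧ ∃ i₀ : ℕ, ∀ i ≥ i₀, x (i + p) = x i})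
    ⟨p, hp, i₀, hi⟩⟩

/-! ### Dimension estimates -/

/-- Equivalent vector states of an eventually periodic sequence have at least the dimension given
by the period length. -/
theorem periodLength_le_rank (hn : 2 ≤ n) {x : Seq n} {d : ℕ} (hd : IsPeriodLength x d)
    {v : SeqSpace n} (hv : v ∈ tailSpace x) (hv0 : v ≠ 0) :
    (d : ℕ∞) ≤ Cardinal.toENat (Module.rank ℂ (shiftCorr hn v)) := by
  obtain ⟨y, hy⟩ := exists_inner_ne_zero hv0
  have hxy : TailEquiv x y := by
    by_contra h
    exact hy (hv y h)
  obtain ⟨k, hk⟩ := hxy.exists_period_iff.mp (eventually_period_iff.mp hd.1.2)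
  refine le_rank_of_basisVec_mem (f := fun j : Fin d => shift (j + k) y) (fun i j hij => ?_)
    fun j => basisVec_mem_shiftCorr hn hy hd.1.1 ?_
  · rcases lt_trichotomy i j with h | h | h
    · exact absurd hij (not_shift_eq_of_lt hd hxy (by omega) (by omega))
    · exact h
    · exact absurd hij.symm (not_shift_eq_of_lt hd hxy (by omega) (by omega))
  · rw [add_assoc, ← shift_shift, hk, shift_shift]

/-- In finite dimension the bounded vectors `Π(s_J)* v`, for prefixes `J` of `y`, would have a
convergent subsequence. The basis vectors `e_{shift m y}` would then converge along it, although
they are orthonormal. -/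
theorem rank_eq_top_of_not_eventuallyPeriodic (hn : 2 ≤ n) {x : Seq n}
    (hx : ¬ EventuallyPeriodic x) {v : SeqSpace n} (hv : v ∈ tailSpace x) (hv0 : v ≠ 0) :
    Cardinal.toENat (Module.rank ℂ (shiftCorr hn v)) = ⊤ := by
  obtain ⟨y, hy⟩ := exists_inner_ne_zero hv0
  have hxy : TailEquiv x y := by
    by_contra h
    exact hy (hv y h)
  have hne : ∀ i j, i < j → shift i y ≠ shift j y := fun i j hij h => hx <| by
    obtain ⟨k, hk⟩ := eventually_period_iff.mpr (hxy.exists_period_iff.mpr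
      ⟨i, show shift (i + (j - i)) y = _ by rw [show i + (j - i) = j by omega, h]⟩)
    exact ⟨k, j - i, by omega, hk⟩
  by_contra htop
  have : FiniteDimensional ℂ (shiftCorr hn v) := by
    rw [FiniteDimensional, ← Module.rank_lt_aleph0_iff]
    by_contra h
    exact htop (Cardinal.toENat_eq_top.mpr (not_lt.mp h))
  have : ProperSpace (shiftCorr hn v) := FiniteDimensional.proper ℂ _
  let w : ℕ → shiftCorr hn v := fun m => ⟨_, mem_shiftCorr hn v (initial m y)⟩
  obtain ⟨u, -, φ, hφ, hlim⟩ := tendsto_subseq_of_bounded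
    (Metric.isBounded_closedBall (x := (0 : shiftCorr hn v)) (r := ‖v‖)) (x := w)
    fun m => mem_closedBall_zero_iff.mpr (norm_shiftRep_star_wordGen_le hn _ v)
  have hlim1 : Tendsto (fun m => shiftRep hn (star (wordGen (initial (φ m) y))) v) atTop
      (𝓝 (u : SeqSpace n)) := (continuous_subtype_val.tendsto u).comp hlim
  set c := ⟪basisVec y, v⟫_ℂ
  have hlim2 : Tendsto (fun m => c • basisVec (shift (φ m) y)) atTop (𝓝 (u : SeqSpace n)) := by
    have := hlim1.sub ((tendsto_shiftRep_star_initial_sub hn y v).comp hφ.tendsto_atTop)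
    simpa using this
  have hlim3 := (hlim2.const_smul c⁻¹)
  simp only [inv_smul_smul₀ hy] at hlim3
  -- Inner products of consecutive terms are 0 and those of a term with itself are 1, yet both must
  -- tend to the squared norm of the limit.
  have h0 := hlim3.inner (𝕜 := ℂ) (hlim3.comp (tendsto_add_atTop_nat 1))
  have h1 := hlim3.inner (𝕜 := ℂ) hlim3
  simp only [Function.comp_apply, inner_basisVec_self] at h0 h1
  have h2 := h0.congr fun m => (orthonormal_basisVec n).2 (hne _ _ (hφ (Nat.lt_succ_self m)))
  exact zero_ne_one ((tendsto_nhds_unique tendsto_const_nhds h2).trans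
    (tendsto_nhds_unique h1 tendsto_const_nhds))

/-- A purely periodic sequence has dimension at most any of its periods. -/
theorem rank_le_of_shift_eq (hn : 2 ≤ n) {y : Seq n} {d : ℕ} (hd : 1 ≤ d)
    (hy : shift d y = y) :
    Cardinal.toENat (Module.rank ℂ (shiftCorr hn (basisVec y))) ≤ d := by
  have hmul : ∀ q, shift (q * d) y = y := by
    intro q
    induction q with
    | zero => simp
    | succ q ih => rw [show (q + 1) * d = q * d + d by ring, ← shift_shift, hy, ih]
  have hmod : ∀ m, shift m y = shift (m % d) y := fun m => by
    conv_lhs => rw [← Nat.mod_add_div' m d, ← shift_shift, hmul]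
  set F := Set.range fun j : Fin d => basisVec (shift j y)
  have hF : F.Finite := Set.finite_range _
  have : FiniteDimensional ℂ (Submodule.span ℂ F) := FiniteDimensional.span_of_finite ℂ hF
  have hle : shiftCorr hn (basisVec y) ≤ Submodule.span ℂ F := by
    refine Submodule.topologicalClosure_minimal _ (Submodule.span_le.mpr ?_)
      (Submodule.closed_of_finiteDimensional _)
    rintro _ ⟨J, rfl⟩
    -- Either `J` is a prefix of `y` and `Π(s_J)*` shifts `y` by its length, which matters only
    -- modulo `d`, or it kills `e_y`.
    by_cases hJ : ∃ z, append J z = y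
    · obtain ⟨z, hz⟩ := hJ
      have h1 : shiftRep hn (star (wordGen J)) (basisVec y) = basisVec z := by
        conv_lhs => rw [← hz]
        exact shiftRep_star_wordGen_append hn J z
      have h2 : z = shift (J.length % d) y := by
        rw [← hmod]
        conv_rhs => rw [← hz]
        exact (shift_length_append J z).symm
      change shiftRep hn (star (wordGen J)) (basisVec y) ∈ _
      rw [h1, h2]
      exact Submodule.subset_span ⟨⟨_, Nat.mod_lt _ hd⟩, rfl⟩
    · change shiftRep hn (star (wordGen J)) (basisVec y) ∈ _
      rw [shiftRep_star_wordGen_of_ne hn J (by simpa using hJ)]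
      exact Submodule.zero_mem _
  rw [Cardinal.toENat_le_natCast]
  refine (Submodule.rank_mono hle).trans ((rank_span_le F).trans ?_)
  exact Cardinal.mk_range_le.trans (by simp)

theorem kappa_le_periodLength (hn : 2 ≤ n) {x : Seq n} {d : ℕ} (hd : IsPeriodLength x d) :
    kappa (shiftState hn x) ≤ d := by
  obtain ⟨k, hk⟩ := eventually_period_iff.mp hd.1.2
  have h : cdim (shiftState hn (shift k x)) ≤ d := by
    rw [cdim_shiftState]
    exact rank_le_of_shift_eq hn hd.1.1 (by rw [shift_shift, add_comm, hk])
  exact le_trans (sInf_le ⟨_, gnsEquivalent_shift hn x k, rfl⟩) h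

theorem kappa_eq_periodLength (hn : 2 ≤ n) {x : Seq n} {d : ℕ} (hd : IsPeriodLength x d) :
    kappa (shiftState hn x) = d := by
  refine le_antisymm (kappa_le_periodLength hn hd) (le_sInf ?_)
  rintro _ ⟨ω, hω, rfl⟩
  obtain ⟨v, hv, hv0, h⟩ := exists_cdim_eq_of_gnsEquivalent hn hω
  rw [h]
  exact periodLength_le_rank hn hd hv hv0

theorem kappa_eq_top (hn : 2 ≤ n) {x : Seq n} (hx : ¬ EventuallyPeriodic x) :
    kappa (shiftState hn x) = ⊤ := by
  refine sInf_eq_top.mpr ?_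
  rintro _ ⟨ω, hω, rfl⟩
  obtain ⟨v, hv, hv0, h⟩ := exists_cdim_eq_of_gnsEquivalent hn hω
  rw [h]
  exact rank_eq_top_of_not_eventuallyPeriodic hn hx hv hv0

theorem kappa_le_cdim (hn : 2 ≤ n) (x : Seq n) :
    kappa (shiftState hn x) ≤ cdim (shiftState hn x) :=
  -- Shifting by zero letters supplies reflexivity of GNS equivalence.
  sInf_le ⟨_, gnsEquivalent_shift hn x 0, rfl⟩

/-- Moving any index past the preperiod by a multiple of a pure period `p` changes no letter, so an
eventual period already holds from the start. -/
theorem PurelyPeriodic.shift_eq {x : Seq n} (hx : PurelyPeriodic x) {d k : ℕ}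
    (h : shift (k + d) x = shift k x) : shift d x = x := by
  obtain ⟨p, hp, hper⟩ := hx
  have hmul : ∀ q i, x (i + q * p) = x i := by
    intro q
    induction q with
    | zero => simp
    | succ q ih => intro i; rw [show i + (q + 1) * p = i + q * p + p by ring, hper, ih]
  -- Evaluating `h` at `i + r` compares `x` at `i + d + k p` and `i + k p`, that is, at `i + d` and
  -- `i`.
  obtain ⟨r, hr⟩ : ∃ r, k * p = r + k := ⟨k * p - k, by
    rw [Nat.sub_add_cancel (Nat.le_mul_of_pos_right k hp)]⟩
  funext i
  have h1 := congrFun h (i + r)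
  simp only [shift] at h1 ⊢
  rw [← hmul k (i + d), ← hmul k i, hr]
  rw [show i + r + (k + d) = i + d + (r + k) by ring, add_assoc i r k] at h1
  exact h1

theorem isMinimal_iff_purelyPeriodic (hn : 2 ≤ n) {x : Seq n} {d : ℕ}
    (hd : IsPeriodLength x d) : IsMinimal (shiftState hn x) ↔ PurelyPeriodic x := by
  rw [IsMinimal, kappa_eq_periodLength hn hd]
  constructor
  · intro hcdim
    by_contra hx
    have hinj : Function.Injective fun j : Fin (d + 1) => shift (j : ℕ) x := by
      have key : ∀ i j : Fin (d + 1), i < j → shift (i : ℕ) x ≠ shift (j : ℕ) x := by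
        intro i j hij h
        -- Among the shifts by `0, …, d`, only those by `0` and `d` could coincide without
        -- contradicting minimality of `d`, and that coincidence is pure periodicity.
        by_cases hlt : (j : ℕ) < i + d
        · exact not_shift_eq_of_lt hd (.refl x) hij hlt h
        · rw [show (i : ℕ) = 0 by omega, show (j : ℕ) = d by omega] at h
          exact hx ⟨d, hd.1.1, fun k => (congrFun h k).symm⟩
      intro i j hij
      rcases lt_trichotomy i j with h | h | h
      · exact absurd hij (key i j h)
      · exact h
      · exact absurd hij.symm (key j i h)
    have hle := le_rank_of_basisVec_mem (S := shiftCorr hn (basisVec x)) hinj fun j => by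
      have := mem_shiftCorr hn (basisVec x) (initial j x)
      rwa [shiftRep_star_initial] at this
    rw [← cdim_shiftState, hcdim] at hle
    exact absurd (Nat.cast_le.mp hle) (by omega)
  · intro hx
    obtain ⟨k, hk⟩ := eventually_period_iff.mp hd.1.2
    refine le_antisymm ?_ (kappa_eq_periodLength hn hd ▸ kappa_le_cdim hn x)
    rw [cdim_shiftState]
    exact rank_le_of_shift_eq hn hd.1.1 (hx.shift_eq hk)

end CuntzStates
end

open CuntzStates in
theorem proposition3p12 (n : ℕ∞) (hn : 2 ≤ n) (x : Seq n) :
    IsPure (shiftState hn x) ∧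
    (¬ EventuallyPeriodic x → kappa (shiftState hn x) = ⊤) ∧
    (EventuallyPeriodic x → ∀ d : ℕ, IsPeriodLength x d → kappa (shiftState hn x) = d) ∧
    (EventuallyPeriodic x → (IsMinimal (shiftState hn x) ↔ PurelyPeriodic x)) :=
  ⟨isPure_shiftState hn x, kappa_eq_top hn, fun _ _ hd => kappa_eq_periodLength hn hd,
    fun hx => hx.exists_isPeriodLength.elim fun _ hd => isMinimal_iff_purelyPeriodic hn hd⟩
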